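/- Let $T>0$, $\Omega=[x_L,x_R]$ with $x_L<x_R$, and $K=[0,T]\times\Omega$. Let the potential $\Phi$ be differentiable on $(x_L,x_R)$ with $\partial_x\Phi$ bounded there, and let $\lambda_1,\lambda_2\in\mathbb R$. Let $G$ be the Stage-1 learned flux derivative (the learned replacement for $\partial_x m_2$), in either of the following two forms: (a) a given function $G[m_0,m_1](t,x)=q(t,x)$, the same for all moments; or (b) $G[m_0,m_1](t,x)=\mathcal N\big(m_0,m_1,\partial_xm_0,\partial_xm_1\big)(t,x)$, where $\mathcal N:\mathbb R^4\to\mathbb R$ is a fully connected feed-forward neural network of arbitrary depth and widths with continuous activation functions. Consider the moment system $$\partial_t m_0+\partial_x m_1=0,\qquad \partial_t m_1+G[m_0,m_1]=-m_0\,\partial_x\Phi .$$ Suppose that $m_0,m_1\in C^1(K)$ satisfy this system in the interior of $K$, the initial conditions $m_0(0,\cdot)=a_0$, $m_1(0,\cdot)=a_1$ on $\Omega$, and the periodic boundary conditions $m_k(t,x_L)=m_k(t,x_R)$ for $t\in[0,T]$, $k=0,1$. For functions $u_0,u_1$ of $(t,x)$ put $$Loss_{GE}=\int_K|\partial_tu_0+\partial_xu_1|^2\,dx\,dt+\int_K|\partial_tu_1+G[u_0,u_1]+u_0\,\partial_x\Phi|^2\,dx\,dt,$$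 $$Loss_{BC}=\sum_{k=0}^1\int_0^T|u_k(s,x_L)-u_k(s,x_R)|^2\,ds,\qquad Loss_{IC}=\sum_{k=0}^1\int_\Omega|u_k(0,x)-a_k(x)|^2\,dx,$$ $$Loss_{stage2}(u_0,u_1)=Loss_{GE}+\lambda_1Loss_{BC}+\lambda_2Loss_{IC}.$$ Let $\sigma\in C^1(\mathbb R)$ be an activation function that is not a polynomial. Then there are sequences $((m_0)_j)_{j}$ and $((m_1)_j)_{j}$ of two-layer neural networks, each of the form $$(t,x)\mapsto\sum_{i=1}^{n}w^{(2)}_{i}\,\sigma\big(w^{(1)}_{i1}t+w^{(1)}_{i2}x+b^{(1)}_i\big)+b^{(2)},$$ with numbers of nodes, weights and biases depending on $k\in\{0,1\}$ and $j$, such that all integrands in $Loss_{stage2}\big((m_0)_j,(m_1)_j\big)$ are integrable and $$Loss_{stage2}\big((m_0)_j,(m_1)_j\big)\to0\qquad\text{as }j\to\infty .$$ -/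

import Mathlib

open Set Filter Topology MeasureTheory

namespace MomentPINN

noncomputable section

/-- Partial derivative in time of a function of `(t, x)`. -/
def dt (f : ℝ → ℝ → ℝ) (t x : ℝ) : ℝ := deriv (fun s => f s x) t

/-- Partial derivative in space of a function of `(t, x)`. -/
def dx (f : ℝ → ℝ → ℝ) (t x : ℝ) : ℝ := deriv (fun y => f t y) x

/-- The space-time domain `K = [0, T] × Ω` with `Ω = [xL, xR]`. -/
def domainK (T xL xR : ℝ) : Set (ℝ × ℝ) := Icc 0 T ×ˢ Icc xL xR

/-- Weights of a two-layer network (one hidden layer) with input `(t, x)` and scalar output: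
the number of nodes, the weights and biases of the hidden layer, the weights and the bias of
the output layer. -/
structure TwoLayerNet where
  nodes : ℕ
  innerT : Fin nodes → ℝ
  innerX : Fin nodes → ℝ
  innerBias : Fin nodes → ℝ
  outer : Fin nodes → ℝ
  outerBias : ℝ

/-- The function `(t, x) ↦ ∑ i, w₂ i * σ (w₁ i • (t, x) + b₁ i) + b₂` computed by the network. -/
def TwoLayerNet.eval (σ : ℝ → ℝ) (θ : TwoLayerNet) (t x : ℝ) : ℝ :=
  ∑ i, θ.outer i * σ (θ.innerT i * t + θ.innerX i * x + θ.innerBias i) + θ.outerBias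

/-- Fully connected feed-forward networks from `ℝⁿ` to `ℝᵏ` of arbitrary depth and widths:
an affine map, or a network followed by a continuous activation function
(applied to every coordinate) and an affine map. -/
inductive FullyConnectedNet (n : ℕ) : ℕ → Type where
  | input {k : ℕ} (W : Matrix (Fin k) (Fin n) ℝ) (b : Fin k → ℝ) : FullyConnectedNet n k
  | layer {l k : ℕ} (N : FullyConnectedNet n l) (act : C(ℝ, ℝ))
      (W : Matrix (Fin k) (Fin l) ℝ) (b : Fin k → ℝ) : FullyConnectedNet n k

/-- The function computed by a fully connected network. -/
def FullyConnectedNet.eval {n : ℕ} :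
    {k : ℕ} → FullyConnectedNet n k → (Fin n → ℝ) → (Fin k → ℝ)
  | _, .input W b, z => W.mulVec z + b
  | _, .layer N act W b, z => W.mulVec (fun i => act (N.eval z i)) + b

/-- The learned flux derivative `∂ₓ m₂` delivered by Stage 1, in the two ways in which it can
enter the Stage-2 equations: `field q` is a fixed function of `(t, x)` (the values that the
trained network has produced from its data), and `network N` is the trained network itself,
fed with the moments on which the equations are imposed. -/
inductive Stage1Flux where
  | field (q : ℝ → ℝ → ℝ) : Stage1Flux
  | network (N : FullyConnectedNet 4 1) : Stage1Flux

/-- The value of the learned `∂ₓ m₂` at `(t, x)` for the moments `m₀, m₁`. -/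
def Stage1Flux.eval : Stage1Flux → (ℝ → ℝ → ℝ) → (ℝ → ℝ → ℝ) → ℝ → ℝ → ℝ
  | .field q, _, _, t, x => q t x
  | .network N, m₀, m₁, t, x => N.eval ![m₀ t x, m₁ t x, dx m₀ t x, dx m₁ t x] 0

/-- Residual of `∂ₜ m₀ + ∂ₓ m₁ = 0`. -/
def residual₁ (m₀ m₁ : ℝ → ℝ → ℝ) (t x : ℝ) : ℝ := dt m₀ t x + dx m₁ t x

/-- Residual of `∂ₜ m₁ + ∂ₓ m₂ = - m₀ ∂ₓ Φ`, where `∂ₓ m₂` is the Stage-1 flux derivative. -/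
def residual₂ (Φ : ℝ → ℝ) (G : Stage1Flux) (m₀ m₁ : ℝ → ℝ → ℝ) (t x : ℝ) : ℝ :=
  dt m₁ t x + G.eval m₀ m₁ t x + m₀ t x * deriv Φ x

/-- `(m₀, m₁)` is a `C¹(K)` solution of the moment system with the Stage-1 flux, with initial
profiles `(a₀, a₁)` and periodic boundary conditions. -/
structure IsC1Solution (T xL xR : ℝ) (Φ : ℝ → ℝ) (G : Stage1Flux) (a₀ a₁ : ℝ → ℝ)
    (m₀ m₁ : ℝ → ℝ → ℝ) : Prop where
  contDiffOn₀ : ContDiffOn ℝ 1 (Function.uncurry m₀) (domainK T xL xR)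
  contDiffOn₁ : ContDiffOn ℝ 1 (Function.uncurry m₁) (domainK T xL xR)
  eq₁ : ∀ t ∈ Ioo 0 T, ∀ x ∈ Ioo xL xR, residual₁ m₀ m₁ t x = 0
  eq₂ : ∀ t ∈ Ioo 0 T, ∀ x ∈ Ioo xL xR, residual₂ Φ G m₀ m₁ t x = 0
  initial₀ : ∀ x ∈ Icc xL xR, m₀ 0 x = a₀ x
  initial₁ : ∀ x ∈ Icc xL xR, m₁ 0 x = a₁ x
  periodic₀ : ∀ t ∈ Icc 0 T, m₀ t xL = m₀ t xR
  periodic₁ : ∀ t ∈ Icc 0 T, m₁ t xL = m₁ t xR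

/-- Loss of the governing equations. -/
def lossGE (T xL xR : ℝ) (Φ : ℝ → ℝ) (G : Stage1Flux) (u₀ u₁ : ℝ → ℝ → ℝ) : ℝ :=
  (∫ p in domainK T xL xR, residual₁ u₀ u₁ p.1 p.2 ^ 2) +
    ∫ p in domainK T xL xR, residual₂ Φ G u₀ u₁ p.1 p.2 ^ 2

/-- Loss of the periodic boundary conditions. -/
def lossBC (T xL xR : ℝ) (u₀ u₁ : ℝ → ℝ → ℝ) : ℝ :=
  (∫ s in Icc 0 T, (u₀ s xL - u₀ s xR) ^ 2) + ∫ s in Icc 0 T, (u₁ s xL - u₁ s xR) ^ 2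

/-- Loss of the initial conditions. -/
def lossIC (xL xR : ℝ) (a₀ a₁ : ℝ → ℝ) (u₀ u₁ : ℝ → ℝ → ℝ) : ℝ :=
  (∫ x in Icc xL xR, (u₀ 0 x - a₀ x) ^ 2) + ∫ x in Icc xL xR, (u₁ 0 x - a₁ x) ^ 2

/-- The Stage-2 loss. -/
def lossStage2 (T xL xR : ℝ) (Φ : ℝ → ℝ) (G : Stage1Flux) (a₀ a₁ : ℝ → ℝ) (lam₁ lam₂ : ℝ)
    (u₀ u₁ : ℝ → ℝ → ℝ) : ℝ :=
  lossGE T xL xR Φ G u₀ u₁ + lam₁ * lossBC T xL xR u₀ u₁ + lam₂ * lossIC xL xR a₀ a₁ u₀ u₁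

/-- All integrals in the Stage-2 loss are genuine, that is, their integrands are integrable. -/
structure LossIntegrable (T xL xR : ℝ) (Φ : ℝ → ℝ) (G : Stage1Flux) (a₀ a₁ : ℝ → ℝ)
    (u₀ u₁ : ℝ → ℝ → ℝ) : Prop where
  ge₁ : IntegrableOn (fun p : ℝ × ℝ => residual₁ u₀ u₁ p.1 p.2 ^ 2) (domainK T xL xR)
  ge₂ : IntegrableOn (fun p : ℝ × ℝ => residual₂ Φ G u₀ u₁ p.1 p.2 ^ 2) (domainK T xL xR)
  bc₀ : IntegrableOn (fun s => (u₀ s xL - u₀ s xR) ^ 2) (Icc 0 T)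
  bc₁ : IntegrableOn (fun s => (u₁ s xL - u₁ s xR) ^ 2) (Icc 0 T)
  ic₀ : IntegrableOn (fun x => (u₀ 0 x - a₀ x) ^ 2) (Icc xL xR)
  ic₁ : IntegrableOn (fun x => (u₁ 0 x - a₁ x) ^ 2) (Icc xL xR)

end

end MomentPINN

namespace MomentPINN

open scoped ContDiff Pointwise Manifold

/-! Density of networks in `C¹` is the whole matter. A solution has zero residual in the interior of
`K`, so the residuals of nearby networks there are differences of nearby quantities. The two values
of `G` coincide for a fixed field, and are close for a network flux by uniform continuity on a ball.
The frontier of the convex set `K` is null, and the initial and boundary errors are differences as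
well, so the loss is of order `η ^ 2` (`exists_twoLayerNet_loss_le`).

Density starts in one variable. Let `V` be the closed span of the jets (value and derivative) of `s
↦ σ (l s + b)`. It contains the jets of every mollification `φ * σ`, as Bochner integrals.
Differentiating these `k` times in `l` at `l = 0` gives the jet of `s ^ k` times the `k`-th
derivative of `φ * σ` at `b`. If this factor always vanished for mollifiers shrinking to a point,
`σ` would be a limit of polynomials of degree below `k`, hence a polynomial. So `V` contains all
monomials (`powJet_mem`) and, by the power series, `exp` (`expJet_mem`).

In several variables every `exp ∘ ℓ` is therefore a `C¹` limit of ridge functions. A compactly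
supported `C¹` function `f` is close to some `φ * f`; Stone-Weierstrass replaces `φ` by a
combination `q` of exponentials, and `q * f` is again such a combination. All derivatives fall on
`f`, so closeness is in `C¹` (`isC1Limit_of_hasCompactSupport`). A function on a convex body is
first reduced to this case by a contraction and a cutoff (`exists_contDiff_near_of_convex`). -/

/-! ### Calculus inside closed subspaces -/

/-- A curve of continuous functions on a compact space whose pointwise derivatives form a
continuous curve is differentiable in the supremum norm. -/
theorem hasDerivAt_continuousMap {X F : Type*} [TopologicalSpace X] [CompactSpace X]
    [NormedAddCommGroup F] [NormedSpace ℝ F] [CompleteSpace F] {Γ Γ' : ℝ → C(X, F)}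
    (hc : Continuous Γ') (h : ∀ x l, HasDerivAt (fun r => Γ r x) (Γ' l x) l) (l : ℝ) :
    HasDerivAt Γ (Γ' l) l := by
  -- The pointwise fundamental theorem of calculus becomes an identity of Bochner integrals, which
  -- can be differentiated in norm.
  have key : Γ = fun r => Γ 0 + ∫ s in (0 : ℝ)..r, Γ' s := by
    funext r
    ext x
    have h1 : (∫ s in (0 : ℝ)..r, Γ' s) x = ∫ s in (0 : ℝ)..r, Γ' s x := by
      exact (ContinuousLinearMap.intervalIntegral_comp_comm (ContinuousMap.evalCLM ℝ x)
        (hc.intervalIntegrable (μ := volume) 0 r)).symm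
    have h2 := intervalIntegral.integral_eq_sub_of_hasDerivAt (a := 0) (b := r)
      (fun s _ => h x s)
      (((ContinuousMap.evalCLM ℝ x).continuous.comp hc).intervalIntegrable (μ := volume) 0 r)
    rw [ContinuousMap.add_apply, h1, h2]
    abel
  rw [key]
  exact (intervalIntegral.integral_hasDerivAt_right (hc.intervalIntegrable _ _)
    (hc.stronglyMeasurableAtFilter _ _) hc.continuousAt).const_add _

theorem hasDerivAt_mem_of_forall_mem {E : Type*} [NormedAddCommGroup E] [NormedSpace ℝ E]
    {V : Submodule ℝ E} (hV : IsClosed (V : Set E)) {Γ : ℝ → E} {e : E} {l : ℝ}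
    (h : HasDerivAt Γ e l) (hΓ : ∀ r, Γ r ∈ V) : e ∈ V := by
  refine hV.mem_of_tendsto h.tendsto_slope (Eventually.of_forall fun r => ?_)
  simp only [slope, vsub_eq_sub]
  exact V.smul_mem _ (V.sub_mem (hΓ _) (hΓ _))

theorem integral_mem_of_isClosed {α E : Type*} [MeasurableSpace α] {μ : Measure α}
    [NormedAddCommGroup E] [NormedSpace ℝ E] [CompleteSpace E]
    {V : Submodule ℝ E} (hV : IsClosed (V : Set E)) {f : α → E} (hf : Integrable f μ)
    (h : ∀ a, f a ∈ V) : ∫ a, f a ∂μ ∈ V := by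
  by_contra hn
  obtain ⟨L, u, hL1, hL2⟩ := geometric_hahn_banach_closed_point V.convex hV hn
  have hz : ∀ v ∈ V, L v = 0 := by
    intro v hv
    by_contra hne
    -- `L` takes the value `u` at this multiple of `v`, although `L < u` on `V`.
    have := hL1 _ (V.smul_mem (u / L v) hv)
    rw [map_smul, smul_eq_mul, div_mul_cancel₀ _ hne] at this
    exact lt_irrefl _ this
  have h0 := hL1 0 V.zero_mem
  rw [map_zero] at h0
  rw [← L.integral_comp_comm hf] at hL2
  simp [hz _ (h _)] at hL2
  linarith

/-! ### Recognizing polynomials -/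

/-- A smooth function with vanishing `k`-th derivative is a polynomial of degree below `k`. -/
theorem exists_polynomial_of_iteratedDeriv_eq_zero (k : ℕ) : ∀ g : ℝ → ℝ, ContDiff ℝ ∞ g →
    (∀ x, iteratedDeriv k g x = 0) →
    ∃ P : Polynomial ℝ, P.degree < k ∧ ∀ x, g x = P.eval x := by
  induction k with
  | zero =>
    intro g _ h
    exact ⟨0, by simp, fun x => by simpa using h x⟩
  | succ k ih =>
    intro g hg h
    obtain ⟨P, hP, hPe⟩ := ih (deriv g) ((contDiff_infty_iff_deriv.1 hg).2)
      (fun x => by rw [← iteratedDeriv_succ']; exact h x)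
    -- The antiderivative of `P` without constant term.
    let Q : Polynomial ℝ := ∑ i ∈ Finset.range k,
      Polynomial.monomial (i + 1) (P.coeff i / (i + 1))
    have hQd : ∀ x, Q.derivative.eval x = deriv g x := by
      intro x
      rw [hPe]
      congr 1
      have hP' : P = ∑ i ∈ Finset.range k, Polynomial.monomial i (P.coeff i) := by
        ext j
        simp only [Polynomial.finsetSum_coeff, Polynomial.coeff_monomial, Finset.sum_ite_eq',
          Finset.mem_range]
        split_ifs with hj
        · rfl
        · exact Polynomial.coeff_eq_zero_of_degree_lt
            (hP.trans_le (by exact_mod_cast not_lt.1 hj))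
      conv_rhs => rw [hP']
      rw [Polynomial.derivative_sum]
      refine Finset.sum_congr rfl fun i _ => ?_
      rw [Polynomial.derivative_monomial]
      congr 1
      have : (i : ℝ) + 1 ≠ 0 := by positivity
      push_cast
      field_simp
    have hconst : ∀ x, g x - Q.eval x = g 0 - Q.eval 0 := by
      have hd : Differentiable ℝ g := (contDiff_infty_iff_deriv.1 hg).1
      intro x
      refine is_const_of_deriv_eq_zero (f := fun x => g x - Q.eval x)
        (hd.sub Q.differentiable) (fun y => ?_) x 0
      have := ((hd y).hasDerivAt.sub (Q.hasDerivAt y)).deriv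
      rw [hQd, sub_self] at this
      exact this
    refine ⟨Q + Polynomial.C (g 0 - Q.eval 0), ?_, fun x => ?_⟩
    · refine lt_of_le_of_lt (Polynomial.degree_add_le _ _) (max_lt ?_ ?_)
      · refine lt_of_le_of_lt (Polynomial.degree_sum_le _ _) ?_
        rw [Finset.sup_lt_iff (by exact WithBot.bot_lt_coe _)]
        intro i hi
        refine lt_of_le_of_lt (Polynomial.degree_monomial_le _ _) ?_
        have := Finset.mem_range.1 hi
        exact_mod_cast Nat.succ_lt_succ this
      · refine lt_of_le_of_lt Polynomial.degree_C_le ?_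
        exact_mod_cast Nat.succ_pos k
    · have := hconst x
      simp only [Polynomial.eval_add, Polynomial.eval_C]
      linarith

/-- A pointwise limit of polynomials of degree below `k` is a polynomial. -/
theorem exists_polynomial_of_tendsto (k : ℕ) (g : ℕ → ℝ → ℝ) (f : ℝ → ℝ)
    (hg : ∀ n, ∃ P : Polynomial ℝ, P.degree < k ∧ ∀ x, g n x = P.eval x)
    (h : ∀ x, Tendsto (fun n => g n x) atTop (𝓝 (f x))) :
    ∃ P : Polynomial ℝ, ∀ x, f x = P.eval x := by
  have hinj : Set.InjOn (fun i : ℕ => (i : ℝ)) (Finset.range k : Set ℕ) :=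
    fun i _ j _ hij => Nat.cast_injective hij
  -- Degree below `k` means determined by the values at `0, …, k - 1`, through a formula linear in
  -- them; pointwise convergence passes through it.
  refine ⟨Lagrange.interpolate (Finset.range k) (fun i : ℕ => (i : ℝ)) (fun i => f i),
    fun x => ?_⟩
  refine tendsto_nhds_unique (h x) ?_
  have : ∀ n, g n x = (Lagrange.interpolate (Finset.range k) (fun i : ℕ => (i : ℝ))
      (fun i => g n i)).eval x := by
    intro n
    obtain ⟨P, hP, hPe⟩ := hg n
    rw [hPe, ← Lagrange.eq_interpolate_of_eval_eq (fun i : ℕ => g n i) hinj (f := P)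
      (by simpa using hP) (fun i _ => (hPe i).symm)]
  simp only [this, Lagrange.interpolate_apply, Polynomial.eval_finsetSum, Polynomial.eval_mul,
    Polynomial.eval_C]
  exact tendsto_finsetSum _ fun i _ => (h i).mul_const _

/-! ### One-variable jets: from `σ` to monomials to `exp` -/

/-- On `[-R, R]`, the pair consisting of `s ↦ h (l s + b)` and of its derivative, for a function
`h` with derivative `h'`. -/
def dilationJet (R : ℝ) (h h' : C(ℝ, ℝ)) (l b : ℝ) : C(Icc (-R) R, ℝ × ℝ) :=
  ⟨fun s => (h (l * s + b), l * h' (l * s + b)), by fun_prop⟩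

/-- On `[-R, R]`, the pair consisting of `s ↦ s ^ k` and of its derivative. -/
def powJet (R : ℝ) (k : ℕ) : C(Icc (-R) R, ℝ × ℝ) :=
  ⟨fun s => ((s : ℝ) ^ k, k * (s : ℝ) ^ (k - 1)), by fun_prop⟩

/-- On `[-R, R]`, the pair consisting of `exp` and of its derivative. -/
noncomputable def expJet (R : ℝ) : C(Icc (-R) R, ℝ × ℝ) :=
  ⟨fun s => (Real.exp s, Real.exp s), by fun_prop⟩

/-- Integration by parts without boundary terms. It reconciles the two derivatives of `φ * σ`: the
one on `φ` gives smoothness, the one on `σ` is what the jets contain. -/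
theorem integral_comp_sub_mul_deriv {φ σ : ℝ → ℝ} (hφ : ContDiff ℝ 1 φ)
    (hφc : HasCompactSupport φ) (hσ : ContDiff ℝ 1 σ) (s : ℝ) :
    ∫ y, deriv φ y * σ (s - y) = ∫ y, φ y * deriv σ (s - y) := by
  have hσd : Continuous (deriv σ) := hσ.continuous_deriv le_rfl
  have hφd : Continuous (deriv φ) := hφ.continuous_deriv le_rfl
  have hv : ∀ y, HasDerivAt (fun y => σ (s - y)) (-deriv σ (s - y)) y := by
    intro y
    have h1 := ((hσ.differentiable one_ne_zero) (s - y)).hasDerivAt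
    exact h1.comp_const_sub s y
  have h := MeasureTheory.integral_mul_deriv_eq_deriv_mul_of_integrable
    (u := φ) (u' := deriv φ) (v := fun y => σ (s - y)) (v' := fun y => -deriv σ (s - y))
    (fun y _ => ((hφ.differentiable one_ne_zero) y).hasDerivAt) (fun y _ => hv y)
    (Continuous.integrable_of_hasCompactSupport
      (hφ.continuous.mul (by fun_prop)) hφc.mul_right)
    (Continuous.integrable_of_hasCompactSupport
      (hφd.mul (hσ.continuous.comp (by fun_prop))) hφc.deriv.mul_right)
    (Continuous.integrable_of_hasCompactSupport
      (hφ.continuous.mul (hσ.continuous.comp (by fun_prop))) hφc.mul_right)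
  simp only [mul_neg, integral_neg] at h
  linarith

/-- Mollification preserves membership of all dilated and translated jets in a closed subspace. -/
theorem dilationJet_convolution_mem {R : ℝ} {V : Submodule ℝ C(Icc (-R) R, ℝ × ℝ)}
    (hV : IsClosed (V : Set C(Icc (-R) R, ℝ × ℝ))) {σ φ : ℝ → ℝ} (hσ : ContDiff ℝ 1 σ)
    (hmem : ∀ l b, dilationJet R ⟨σ, hσ.continuous⟩ ⟨deriv σ, hσ.continuous_deriv le_rfl⟩ l b ∈ V)
    (hφ : ContDiff ℝ 1 φ) (hφc : HasCompactSupport φ) {g g' : C(ℝ, ℝ)}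
    (hg : ∀ s, g s = ∫ y, φ y * σ (s - y)) (hg' : ∀ s, g' s = ∫ y, φ y * deriv σ (s - y))
    (l b : ℝ) : dilationJet R g g' l b ∈ V := by
  have hσd : Continuous (deriv σ) := hσ.continuous_deriv le_rfl
  let Γ : ℝ → C(Icc (-R) R, ℝ × ℝ) := fun y =>
    φ y • dilationJet R ⟨σ, hσ.continuous⟩ ⟨deriv σ, hσd⟩ l (b - y)
  have hΓc : Continuous Γ := by
    refine ContinuousMap.continuous_of_continuous_uncurry _ ?_
    have := hσ.continuous
    have := hφ.continuous
    simp only [Γ, dilationJet, ContinuousMap.smul_apply, ContinuousMap.coe_mk]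
    unfold Function.uncurry
    fun_prop
  have hΓi : Integrable Γ := hΓc.integrable_of_hasCompactSupport hφc.smul_right
  have heq : dilationJet R g g' l b = ∫ y, Γ y := by
    ext1 s
    rw [ContinuousMap.integral_apply hΓi]
    have hi : Integrable (fun y => Γ y s) :=
      (ContinuousMap.evalCLM ℝ s).integrable_comp hΓi
    refine Prod.ext ?_ ?_
    · rw [fst_integral hi]
      simp only [dilationJet, ContinuousMap.coe_mk, hg, Γ, ContinuousMap.smul_apply,
        Prod.smul_mk, smul_eq_mul]
      congr 1
      funext y
      congr 2
      ring
    · rw [snd_integral hi]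
      simp only [dilationJet, ContinuousMap.coe_mk, hg', Γ, ContinuousMap.smul_apply,
        Prod.smul_mk, smul_eq_mul]
      rw [← integral_const_mul]
      congr 1
      funext y
      rw [show l * (s : ℝ) + b - y = l * s + (b - y) by ring]
      ring
  rw [heq]
  exact integral_mem_of_isClosed hV hΓi fun y => V.smul_mem _ (hmem _ _)

/-- Differentiating `k` times in the dilation parameter yields the monomial of degree `k`. -/
theorem powJet_mem_of_iteratedDeriv_ne_zero {R : ℝ} {V : Submodule ℝ C(Icc (-R) R, ℝ × ℝ)}
    (hV : IsClosed (V : Set C(Icc (-R) R, ℝ × ℝ))) {g : ℝ → ℝ} (hg : ContDiff ℝ ∞ g)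
    {g' : C(ℝ, ℝ)} (hg' : ∀ s, g' s = deriv g s)
    (hmem : ∀ l b, dilationJet R ⟨g, hg.continuous⟩ g' l b ∈ V) {k : ℕ} {b : ℝ}
    (hk : iteratedDeriv k g b ≠ 0) : powJet R k ∈ V := by
  have hc : ∀ k, Continuous (iteratedDeriv k g) := fun k =>
    hg.continuous_iteratedDeriv k (by exact_mod_cast le_top)
  have hd : ∀ k s, HasDerivAt (iteratedDeriv k g) (iteratedDeriv (k + 1) g s) s := fun k s => by
    rw [iteratedDeriv_succ]
    exact ((hg.differentiable_iteratedDeriv k (by exact_mod_cast WithTop.coe_lt_top _)) s).hasDerivAt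
  -- The `k`-th derivative in `l` of the jet; the second entry is the `s`-derivative of the first,
  -- by the product rule.
  let Γ : ℕ → ℝ → ℝ → C(Icc (-R) R, ℝ × ℝ) := fun k b l =>
    ⟨fun s => ((s : ℝ) ^ k * iteratedDeriv k g (l * s + b),
      k * (s : ℝ) ^ (k - 1) * iteratedDeriv k g (l * s + b)
        + (s : ℝ) ^ k * (l * iteratedDeriv (k + 1) g (l * s + b))), by
      have := hc k
      have := hc (k + 1)
      fun_prop⟩
  have hΓ : ∀ k b l, Γ k b l ∈ V := by
    intro k
    induction k with
    | zero =>
      intro b l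
      convert hmem l b using 1
      ext s <;> simp [Γ, dilationJet, hg', iteratedDeriv_one]
    | succ k ih =>
      intro b l
      refine hasDerivAt_mem_of_forall_mem hV (Γ := Γ k b) (l := l) ?_ (ih b)
      refine hasDerivAt_continuousMap (Γ' := Γ (k + 1) b) ?_ ?_ l
      · refine ContinuousMap.continuous_of_continuous_uncurry _ ?_
        have := hc (k + 1)
        have := hc (k + 1 + 1)
        simp only [Γ, ContinuousMap.coe_mk]
        unfold Function.uncurry
        fun_prop
      · intro s l
        have h0 : HasDerivAt (fun l : ℝ => l * (s : ℝ) + b) s l := by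
          simpa using ((hasDerivAt_id l).mul_const (s : ℝ)).add_const b
        have h1 := (hd k (l * s + b)).comp l h0
        have h2 := (hd (k + 1) (l * s + b)).comp l h0
        have h3 := (h1.const_mul ((s : ℝ) ^ k)).prodMk
          ((h1.const_mul (k * (s : ℝ) ^ (k - 1))).add
            (((hasDerivAt_id l).mul h2).const_mul ((s : ℝ) ^ k)))
        refine h3.congr_deriv ?_
        simp only [Γ, ContinuousMap.coe_mk, Function.comp, id]
        refine Prod.ext ?_ ?_
        · simp only [pow_succ]; ring
        -- For `k = 0` the exponent `k - 1` is truncated, but its factor `k` vanishes.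
        · rcases k with _ | k
          · simp; ring
          · simp only [Nat.add_sub_cancel, pow_succ]; push_cast; ring
  -- At `l = 0` the dilation is constant and only the monomial jet survives.
  have h := V.smul_mem (iteratedDeriv k g b)⁻¹ (hΓ k b 0)
  convert h using 1
  ext s <;> simp [Γ, powJet] <;> field_simp

theorem exists_contDiffBump_seq : ∃ φ : ℕ → ContDiffBump (0 : ℝ),
    Tendsto (fun n => (φ n).rOut) atTop (𝓝 0) :=
  ⟨fun n => ⟨1 / (n + 1) / 2, 1 / (n + 1), by positivity, by
    have : (0 : ℝ) < 1 / (n + 1) := by positivity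
    linarith⟩, tendsto_one_div_add_atTop_nhds_zero_nat⟩

theorem powJet_mem {R : ℝ} {V : Submodule ℝ C(Icc (-R) R, ℝ × ℝ)}
    (hV : IsClosed (V : Set C(Icc (-R) R, ℝ × ℝ))) {σ : ℝ → ℝ} (hσ : ContDiff ℝ 1 σ)
    (hmem : ∀ l b, dilationJet R ⟨σ, hσ.continuous⟩ ⟨deriv σ, hσ.continuous_deriv le_rfl⟩ l b ∈ V)
    (hpoly : ¬ ∃ p : Polynomial ℝ, ∀ x, σ x = p.eval x) (k : ℕ) : powJet R k ∈ V := by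
  by_contra hk
  obtain ⟨φ, hφ⟩ := exists_contDiffBump_seq
  refine hpoly (exists_polynomial_of_tendsto k _ σ (fun n => ?_)
    (ContDiffBump.convolution_tendsto_right_of_continuous (μ := volume) hφ hσ.continuous))
  have hφs : ContDiff ℝ ∞ ((φ n).normed volume) := (φ n).contDiff_normed
  have hφc : HasCompactSupport ((φ n).normed volume) := (φ n).hasCompactSupport_normed
  have hg : ContDiff ℝ ∞ (convolution ((φ n).normed volume) σ
      (ContinuousLinearMap.lsmul ℝ ℝ) volume) :=
    hφc.contDiff_convolution_left _ hφs hσ.continuous.locallyIntegrable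
  refine exists_polynomial_of_iteratedDeriv_eq_zero k _ hg fun b => ?_
  by_contra hne
  refine hk (powJet_mem_of_iteratedDeriv_ne_zero hV hg
    (g' := ⟨_, hg.continuous_deriv (by simp)⟩) (fun _ => rfl) (fun l b => ?_) hne)
  have hφ1 : ContDiff ℝ 1 ((φ n).normed volume) := hφs.of_le (by simp)
  refine dilationJet_convolution_mem hV hσ hmem hφ1 hφc (fun s => ?_) (fun s => ?_) l b
  · simp [convolution_def]
  · rw [← integral_comp_sub_mul_deriv hφ1 hφc hσ]
    simp only [ContinuousMap.coe_mk]
    rw [(hφc.hasDerivAt_convolution_left (ContinuousLinearMap.lsmul ℝ ℝ) hφ1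
      hσ.continuous.locallyIntegrable s).deriv]
    simp [convolution_def]

theorem expJet_mem {R : ℝ} {V : Submodule ℝ C(Icc (-R) R, ℝ × ℝ)}
    (hV : IsClosed (V : Set C(Icc (-R) R, ℝ × ℝ))) (h : ∀ k, powJet R k ∈ V) :
    expJet R ∈ V := by
  have hsum : ∀ s : ℝ, HasSum (fun k : ℕ => s ^ k / k.factorial) (Real.exp s) := by
    intro s
    rw [Real.exp_eq_exp_ℝ]
    exact NormedSpace.expSeries_div_hasSum_exp s
  have hsum' : ∀ s : ℝ, HasSum (fun k : ℕ => k * s ^ (k - 1) / k.factorial) (Real.exp s) := by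
    intro s
    -- The `k = 0` term of the differentiated series is zero; the shifted series is that of `exp`.
    rw [← hasSum_nat_add_iff' 1]
    simp only [Finset.range_one, Finset.sum_singleton, CharP.cast_eq_zero, zero_mul, zero_div,
      sub_zero]
    refine Eq.mp (congrArg (HasSum · (Real.exp s)) (funext fun k => ?_)) (hsum s)
    simp only [Nat.add_sub_cancel, Nat.factorial_succ]
    push_cast
    have : (k : ℝ) + 1 ≠ 0 := by positivity
    field_simp
  let f : ℕ → C(Icc (-R) R, ℝ × ℝ) := fun k => ((k.factorial : ℝ)⁻¹) • powJet R k
  have hf : Summable f := by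
    refine Summable.of_norm_bounded
      (g := fun k : ℕ => |R| ^ k / k.factorial + k * |R| ^ (k - 1) / k.factorial)
      ((hsum |R|).summable.add (hsum' |R|).summable) fun k => ?_
    rw [ContinuousMap.norm_le _ (by positivity)]
    intro s
    have hs : |(s : ℝ)| ≤ |R| := (abs_le.2 s.2).trans (le_abs_self R)
    have h1 : |(s : ℝ)| ^ k ≤ |R| ^ k := pow_le_pow_left₀ (abs_nonneg _) hs k
    have h2 : |(s : ℝ)| ^ (k - 1) ≤ |R| ^ (k - 1) := pow_le_pow_left₀ (abs_nonneg _) hs _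
    simp only [f, ContinuousMap.smul_apply, powJet, ContinuousMap.coe_mk, Prod.smul_mk,
      smul_eq_mul, Prod.norm_mk, Real.norm_eq_abs, abs_mul, abs_inv, Nat.abs_cast, abs_pow]
    have e1 : (k.factorial : ℝ)⁻¹ * |(s : ℝ)| ^ k ≤ |R| ^ k / k.factorial := by
      rw [inv_mul_eq_div]; gcongr
    have e2 : (k.factorial : ℝ)⁻¹ * (k * |(s : ℝ)| ^ (k - 1))
        ≤ k * |R| ^ (k - 1) / k.factorial := by
      rw [inv_mul_eq_div]; gcongr
    have p1 : 0 ≤ |R| ^ k / k.factorial := by positivity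
    have p2 : 0 ≤ k * |R| ^ (k - 1) / k.factorial := by positivity
    exact max_le (by linarith) (by linarith)
  have heq : expJet R = ∑' k, f k := by
    ext1 s
    have hs := hf.hasSum.mapL (ContinuousMap.evalCLM ℝ s)
    refine HasSum.unique (HasSum.prodMk (f := fun k => (f k s).1) (g := fun k => (f k s).2)
      (a := Real.exp s) (b := Real.exp s) ?_ ?_) hs
    · simpa [f, powJet, inv_mul_eq_div] using hsum s
    · simpa [f, powJet, inv_mul_eq_div] using hsum' s
  rw [heq]
  exact hV.mem_of_tendsto hf.hasSum (Eventually.of_forall fun t =>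
    V.sum_mem fun k _ => V.smul_mem _ (h k))

/-- Superpositions of dilates and translates of a `C¹` function that is not a polynomial
approximate `exp`, together with its derivative, uniformly on `[-R, R]`. -/
theorem exists_sum_near_exp {σ : ℝ → ℝ} (hσ : ContDiff ℝ 1 σ)
    (hpoly : ¬ ∃ p : Polynomial ℝ, ∀ x, σ x = p.eval x) (R : ℝ) {ε : ℝ} (hε : 0 < ε) :
    ∃ (n : ℕ) (c l b : Fin n → ℝ), ∀ s ∈ Icc (-R) R,
      |Real.exp s - ∑ i, c i * σ (l i * s + b i)| ≤ ε ∧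
      |Real.exp s - ∑ i, c i * (l i * deriv σ (l i * s + b i))| ≤ ε := by
  let J : ℝ × ℝ → C(Icc (-R) R, ℝ × ℝ) := fun q =>
    dilationJet R ⟨σ, hσ.continuous⟩ ⟨deriv σ, hσ.continuous_deriv le_rfl⟩ q.1 q.2
  let W := Submodule.span ℝ (range J)
  have hV : IsClosed (W.topologicalClosure : Set C(Icc (-R) R, ℝ × ℝ)) :=
    W.isClosed_topologicalClosure
  have hexp : expJet R ∈ W.topologicalClosure := expJet_mem hV (powJet_mem hV hσ
    (fun l b => W.le_topologicalClosure (Submodule.subset_span ⟨(l, b), rfl⟩)) hpoly)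
  obtain ⟨v, hv, hd⟩ := Metric.mem_closure_iff.1 hexp ε hε
  obtain ⟨n, c, q, hq⟩ := Submodule.mem_span_set'.1 hv
  choose r hr using fun i => (q i).2
  refine ⟨n, c, fun i => (r i).1, fun i => (r i).2, fun s hs => ?_⟩
  have hb := (ContinuousMap.dist_apply_le_dist (f := expJet R) (g := v) ⟨s, hs⟩).trans hd.le
  have hvs : v ⟨s, hs⟩ = (∑ i, c i * σ ((r i).1 * s + (r i).2),
      ∑ i, c i * ((r i).1 * deriv σ ((r i).1 * s + (r i).2))) := by
    rw [← hq, ContinuousMap.sum_apply]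
    simp only [ContinuousMap.smul_apply, ← hr]
    refine Prod.ext ?_ ?_
    · rw [Prod.fst_sum]; rfl
    · rw [Prod.snd_sum]; rfl
  rw [hvs, Prod.dist_eq, max_le_iff, Real.dist_eq, Real.dist_eq] at hb
  exact hb

/-! ### Exponentials as `C¹` limits of ridge functions -/

section C1Limit

variable {E : Type*} [NormedAddCommGroup E] [NormedSpace ℝ E]

/-- The linear span of the ridge functions `p ↦ σ (ℓ p + b)`. -/
def ridgeSpan (E : Type*) [NormedAddCommGroup E] [NormedSpace ℝ E] (σ : ℝ → ℝ) :
    Submodule ℝ (E → ℝ) :=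
  Submodule.span ℝ (range fun q : (E →L[ℝ] ℝ) × ℝ => fun p => σ (q.1 p + q.2))

/-- `f` is differentiable and, on `K`, a uniform limit in the `C¹` sense of elements of `W`. -/
def IsC1Limit (W : Submodule ℝ (E → ℝ)) (K : Set E) (f : E → ℝ) : Prop :=
  Differentiable ℝ f ∧ ∀ ε > 0, ∃ u ∈ W, ContDiff ℝ 1 u ∧
    ∀ p ∈ K, |f p - u p| ≤ ε ∧ ‖fderiv ℝ f p - fderiv ℝ u p‖ ≤ ε

variable {W : Submodule ℝ (E → ℝ)} {K : Set E}

theorem IsC1Limit.zero : IsC1Limit W K (0 : E → ℝ) :=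
  ⟨differentiable_const _, fun ε hε => ⟨0, W.zero_mem, contDiff_const, fun p _ => by
    simp [hε.le]⟩⟩

theorem IsC1Limit.add {f g : E → ℝ} (hf : IsC1Limit W K f) (hg : IsC1Limit W K g) :
    IsC1Limit W K (f + g) := by
  refine ⟨hf.1.add hg.1, fun ε hε => ?_⟩
  obtain ⟨u, hu, hu1, hu2⟩ := hf.2 (ε / 2) (by positivity)
  obtain ⟨v, hv, hv1, hv2⟩ := hg.2 (ε / 2) (by positivity)
  refine ⟨u + v, W.add_mem hu hv, hu1.add hv1, fun p hp => ⟨?_, ?_⟩⟩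
  · have h := abs_add_le (f p - u p) (g p - v p)
    have e : (f + g) p - (u + v) p = f p - u p + (g p - v p) := by
      simp only [Pi.add_apply]; ring
    rw [e]
    linarith [(hu2 p hp).1, (hv2 p hp).1]
  · rw [fderiv_add (hf.1 p) (hg.1 p),
      fderiv_add (hu1.differentiable one_ne_zero p) (hv1.differentiable one_ne_zero p),
      add_sub_add_comm]
    exact (norm_add_le _ _).trans (by linarith [(hu2 p hp).2, (hv2 p hp).2])

theorem IsC1Limit.const_smul {f : E → ℝ} (hf : IsC1Limit W K f) (c : ℝ) :
    IsC1Limit W K (c • f) := by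
  refine ⟨hf.1.const_smul c, fun ε hε => ?_⟩
  obtain ⟨u, hu, hu1, hu2⟩ := hf.2 (ε / (|c| + 1)) (by positivity)
  have hc : |c| * (ε / (|c| + 1)) ≤ ε := by
    rw [← mul_div_assoc, div_le_iff₀ (by positivity)]
    nlinarith [abs_nonneg c]
  refine ⟨c • u, W.smul_mem c hu, hu1.const_smul c, fun p hp => ⟨?_, ?_⟩⟩
  · simp only [Pi.smul_apply, smul_eq_mul, ← mul_sub, abs_mul]
    exact (mul_le_mul_of_nonneg_left (hu2 p hp).1 (abs_nonneg c)).trans hc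
  · rw [fderiv_const_smul (hf.1 p), fderiv_const_smul (hu1.differentiable one_ne_zero p),
      ← smul_sub, norm_smul, Real.norm_eq_abs]
    exact (mul_le_mul_of_nonneg_left (hu2 p hp).2 (abs_nonneg c)).trans hc

/-- A `C¹` limit of `C¹` limits is a `C¹` limit. -/
theorem IsC1Limit.of_forall_near {f : E → ℝ} (hf : Differentiable ℝ f)
    (h : ∀ ε > 0, ∃ g, IsC1Limit W K g ∧
      ∀ p ∈ K, |f p - g p| ≤ ε ∧ ‖fderiv ℝ f p - fderiv ℝ g p‖ ≤ ε) : IsC1Limit W K f := by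
  refine ⟨hf, fun ε hε => ?_⟩
  obtain ⟨g, hg, hfg⟩ := h (ε / 2) (by positivity)
  obtain ⟨u, hu, hu1, hu2⟩ := hg.2 (ε / 2) (by positivity)
  refine ⟨u, hu, hu1, fun p hp => ⟨?_, ?_⟩⟩
  · exact (abs_sub_le _ (g p) _).trans (by linarith [(hu2 p hp).1, (hfg p hp).1])
  · exact (norm_sub_le_norm_sub_add_norm_sub _ (fderiv ℝ g p) _).trans
      (by linarith [(hu2 p hp).2, (hfg p hp).2])

theorem isC1Limit_exp {σ : ℝ → ℝ} (hσ : ContDiff ℝ 1 σ)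
    (hpoly : ¬ ∃ p : Polynomial ℝ, ∀ x, σ x = p.eval x) (hK : IsCompact K) (ℓ : E →L[ℝ] ℝ) :
    IsC1Limit (ridgeSpan E σ) K (fun p => Real.exp (ℓ p)) := by
  refine ⟨ℓ.differentiable.exp, fun ε hε => ?_⟩
  -- `R` bounds `ℓ` on `K`; the derivative error gains a factor `‖ℓ‖`, hence the tolerance below.
  obtain ⟨R, hR⟩ := hK.exists_bound_of_continuousOn ℓ.continuous.continuousOn
  obtain ⟨n, c, l, b, hn⟩ := exists_sum_near_exp hσ hpoly R
    (show 0 < ε / (‖ℓ‖ + 1) by positivity)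
  have hle : ε / (‖ℓ‖ + 1) ≤ ε := div_le_self hε.le (by linarith [norm_nonneg ℓ])
  have hle' : ε / (‖ℓ‖ + 1) * ‖ℓ‖ ≤ ε := by
    rw [div_mul_eq_mul_div, div_le_iff₀ (by positivity)]
    nlinarith [norm_nonneg ℓ]
  have hd : ∀ p, HasFDerivAt (fun p => ∑ i, c i * σ (l i * ℓ p + b i))
      ((∑ i, c i * (l i * deriv σ (l i * ℓ p + b i))) • ℓ) p := by
    intro p
    have h1 : HasDerivAt (fun s => ∑ i, c i * σ (l i * s + b i))
        (∑ i, c i * (l i * deriv σ (l i * ℓ p + b i))) (ℓ p) := by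
      refine HasDerivAt.fun_sum fun i _ => HasDerivAt.const_mul _ ?_
      have h2 : HasDerivAt (fun s => l i * s + b i) (l i) (ℓ p) := by
        simpa using ((hasDerivAt_id (ℓ p)).const_mul (l i)).add_const (b i)
      have h3 := HasDerivAt.comp (ℓ p)
        ((hσ.differentiable one_ne_zero) (l i * ℓ p + b i)).hasDerivAt h2
      rw [mul_comm]
      exact h3
    exact h1.comp_hasFDerivAt p ℓ.hasFDerivAt
  refine ⟨fun p => ∑ i, c i * σ (l i * ℓ p + b i), ?_, ?_, fun p hp => ?_⟩
  · have e : (fun p => ∑ i, c i * σ (l i * ℓ p + b i))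
        = ∑ i, c i • fun p : E => σ ((l i • ℓ) p + b i) := by
      funext p
      simp [Finset.sum_apply]
    rw [e]
    exact Submodule.sum_mem _ fun i _ => Submodule.smul_mem _ _
      (Submodule.subset_span ⟨(l i • ℓ, b i), rfl⟩)
  · have := ℓ.contDiff (n := 1)
    fun_prop
  · obtain ⟨h1, h2⟩ := hn (ℓ p) (abs_le.1 (hR p hp))
    refine ⟨h1.trans hle, ?_⟩
    rw [(hd p).fderiv, (ℓ.hasFDerivAt.exp).fderiv, ← sub_smul, norm_smul, Real.norm_eq_abs]
    exact (mul_le_mul_of_nonneg_right h2 (norm_nonneg _)).trans hle'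

/-! ### Convolution and Stone-Weierstrass -/

/-- The algebra of linear combinations of the functions `exp ∘ ℓ`, with `ℓ` a continuous linear
functional. -/
noncomputable def expAlgebra (E : Type*) [NormedAddCommGroup E] [NormedSpace ℝ E] :
    Subalgebra ℝ C(E, ℝ) :=
  Algebra.adjoin ℝ (range fun ℓ : E →L[ℝ] ℝ => (⟨fun p => Real.exp (ℓ p), by fun_prop⟩ : C(E, ℝ)))

/-- Products of exponentials are exponentials, so the generators already form a monoid and its span
is the algebra. -/
theorem mem_span_of_mem_expAlgebra {q : C(E, ℝ)} (hq : q ∈ expAlgebra E) :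
    q ∈ Submodule.span ℝ
      (range fun ℓ : E →L[ℝ] ℝ => (⟨fun p => Real.exp (ℓ p), by fun_prop⟩ : C(E, ℝ))) := by
  let S : Submonoid C(E, ℝ) :=
    { carrier := range fun ℓ : E →L[ℝ] ℝ => ⟨fun p => Real.exp (ℓ p), by fun_prop⟩
      one_mem' := ⟨0, by ext; simp⟩
      mul_mem' := by
        rintro _ _ ⟨ℓ, rfl⟩ ⟨ℓ', rfl⟩
        exact ⟨ℓ + ℓ', by ext; simp [Real.exp_add]⟩ }
  have h : q ∈ Subalgebra.toSubmodule (expAlgebra E) := hq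
  rw [expAlgebra, Algebra.adjoin_eq_span] at h
  have hS : Submonoid.closure (range fun ℓ : E →L[ℝ] ℝ =>
      (⟨fun p => Real.exp (ℓ p), by fun_prop⟩ : C(E, ℝ))) = S := S.closure_eq
  rwa [hS] at h

theorem expAlgebra_separatesPoints : (expAlgebra E).SeparatesPoints := by
  intro x y hxy
  obtain ⟨ℓ, hℓ⟩ := SeparatingDual.exists_separating_of_ne (R := ℝ) hxy
  refine ⟨_, ⟨⟨fun p => Real.exp (ℓ p), by fun_prop⟩, Algebra.subset_adjoin ⟨ℓ, rfl⟩, rfl⟩, ?_⟩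
  simpa using hℓ

variable [MeasurableSpace E] [BorelSpace E] [FiniteDimensional ℝ E] (μ : Measure E)
  [μ.IsAddHaarMeasure]

theorem hasFDerivAt_integral_smul_comp_sub {q f : E → ℝ} (hq : Continuous q)
    (hf : ContDiff ℝ 1 f) (hfc : HasCompactSupport f) (p : E) :
    HasFDerivAt (fun p => ∫ y, q y * f (p - y) ∂μ) (∫ y, q y • fderiv ℝ f (p - y) ∂μ) p := by
  have h := hfc.hasFDerivAt_convolution_right (ContinuousLinearMap.lsmul ℝ ℝ)
    (hq.locallyIntegrable (μ := μ)) hf p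
  exact h

/-- For `p ∈ K` only `y ∈ K - S` contribute, so closeness of `q` and `r` is needed on that set
alone. It serves for `f` and for its derivative. -/
theorem norm_integral_smul_sub_le {F : Type*} [NormedAddCommGroup F] [NormedSpace ℝ F]
    {q r : E → ℝ} (hq : Continuous q) (hr : Continuous r) {f : E → F} (hf : Continuous f)
    (hfc : HasCompactSupport f) {S : Set E} (hS : tsupport f ⊆ S) {η : ℝ}
    (h : ∀ y ∈ K - S, |q y - r y| ≤ η) {p : E} (hp : p ∈ K) :
    ‖∫ y, q y • f (p - y) ∂μ - ∫ y, r y • f (p - y) ∂μ‖ ≤ η * ∫ y, ‖f y‖ ∂μ := by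
  have hc : HasCompactSupport fun y => f (p - y) :=
    hfc.comp_homeomorph (Homeomorph.subLeft p)
  have hfp : Continuous fun y => f (p - y) := by fun_prop
  have hi : ∀ {q : E → ℝ}, Continuous q → Integrable (fun y => q y • f (p - y)) μ :=
    fun hq => (hq.smul hfp).integrable_of_hasCompactSupport hc.smul_left
  rw [← integral_sub (hi hq) (hi hr), ← integral_sub_left_eq_self (fun y => ‖f y‖) μ p,
    ← integral_const_mul]
  refine norm_integral_le_of_norm_le
    ((hfp.norm.integrable_of_hasCompactSupport hc.norm).const_mul η)
    (Eventually.of_forall fun y => ?_)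
  rw [← sub_smul, norm_smul, Real.norm_eq_abs]
  by_cases hy : f (p - y) = 0
  · simp [hy]
  · refine mul_le_mul_of_nonneg_right 
      (h y ⟨p, hp, p - y, hS (subset_tsupport _ hy), sub_sub_cancel p y⟩) (norm_nonneg _)

theorem isC1Limit_integral_of_mem_expAlgebra
    (hexp : ∀ ℓ : E →L[ℝ] ℝ, IsC1Limit W K fun p => Real.exp (ℓ p)) {f : E → ℝ}
    (hf : Continuous f) (hfc : HasCompactSupport f) {q : C(E, ℝ)} (hq : q ∈ expAlgebra E) :
    IsC1Limit W K fun p => ∫ y, q y * f (p - y) ∂μ := by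
  have hi : ∀ (q : C(E, ℝ)) (p : E), Integrable (fun y => q y * f (p - y)) μ := fun q p =>
    (q.continuous.mul (by fun_prop)).integrable_of_hasCompactSupport
      (hfc.comp_homeomorph (Homeomorph.subLeft p)).mul_left
  have hq' := mem_span_of_mem_expAlgebra hq
  clear hq
  induction hq' using Submodule.span_induction with
  | mem q h =>
    obtain ⟨ℓ, rfl⟩ := h
    convert (hexp ℓ).const_smul (∫ y, Real.exp (- ℓ y) * f y ∂μ) using 1
    funext p
    -- After `y ↦ p - y` the exponential splits, leaving a constant times `exp (ℓ p)`.
    rw [← integral_sub_left_eq_self _ μ p]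
    simp only [Pi.smul_apply, smul_eq_mul, ← integral_mul_const, ContinuousMap.coe_mk]
    congr 1
    funext y
    rw [sub_sub_cancel, map_sub, sub_eq_add_neg, Real.exp_add]
    ring
  | zero => simpa using! IsC1Limit.zero
  | add q r _ _ h1 h2 =>
    convert h1.add h2 using 1
    funext p
    simp only [ContinuousMap.add_apply, Pi.add_apply, add_mul]
    exact integral_add (hi q p) (hi r p)
  | smul c q _ h =>
    convert h.const_smul c using 1
    funext p
    simp only [ContinuousMap.smul_apply, Pi.smul_apply, smul_eq_mul, mul_assoc,
      integral_const_mul]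

/-- If every `exp ∘ ℓ` is a `C¹` limit of elements of `W`, then so is every compactly supported
`C¹` function. -/
theorem isC1Limit_of_hasCompactSupport (hK : IsCompact K)
    (hexp : ∀ ℓ : E →L[ℝ] ℝ, IsC1Limit W K fun p => Real.exp (ℓ p)) {f : E → ℝ}
    (hf : ContDiff ℝ 1 f) (hfc : HasCompactSupport f) : IsC1Limit W K f := by
  let μ : Measure E := Measure.addHaar
  have hfd : Continuous (fderiv ℝ f) := hf.continuous_fderiv one_ne_zero
  have hfdc : HasCompactSupport (fderiv ℝ f) := hfc.fderiv ℝ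
  have hdiff : ∀ {q : E → ℝ}, Continuous q →
      Differentiable ℝ fun p => ∫ y, q y * f (p - y) ∂μ := fun hq p =>
    (hasFDerivAt_integral_smul_comp_sub μ hq hf hfc p).differentiableAt
  refine IsC1Limit.of_forall_near (hf.differentiable one_ne_zero) fun ε hε => ?_
  obtain ⟨δ₁, hδ₁, h₁⟩ := Metric.uniformContinuous_iff.1
    (hfc.uniformContinuous_of_continuous hf.continuous) ε hε
  obtain ⟨δ₂, hδ₂, h₂⟩ := Metric.uniformContinuous_iff.1
    (hfdc.uniformContinuous_of_continuous hfd) ε hε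
  have hδ : 0 < min δ₁ δ₂ := lt_min hδ₁ hδ₂
  let φ : ContDiffBump (0 : E) := ⟨min δ₁ δ₂ / 2, min δ₁ δ₂, by positivity, by linarith⟩
  have hφ : Continuous (φ.normed μ) := φ.continuous_normed
  refine ⟨fun p => ∫ y, φ.normed μ y * f (p - y) ∂μ,
    IsC1Limit.of_forall_near (hdiff hφ) fun η hη => ?_, fun p _ => ⟨?_, ?_⟩⟩
  · let M := (∫ y, ‖f y‖ ∂μ) + (∫ y, ‖fderiv ℝ f y‖ ∂μ) + 1
    have hM1 : 0 ≤ ∫ y, ‖f y‖ ∂μ := integral_nonneg fun _ => norm_nonneg _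
    have hM2 : 0 ≤ ∫ y, ‖fderiv ℝ f y‖ ∂μ := integral_nonneg fun _ => norm_nonneg _
    have hM : 0 < M := by positivity
    obtain ⟨q, hq, hqφ⟩ :=
      ContinuousMap.exists_mem_subalgebra_near_continuous_of_isCompact_of_separatesPoints
        (expAlgebra_separatesPoints (E := E)) ⟨_, hφ⟩ (K := K - tsupport f)
        (sub_eq_add_neg K (tsupport f) ▸ hK.add (IsCompact.neg hfc)) (div_pos hη hM)
    have hclose : ∀ y ∈ K - tsupport f, |φ.normed μ y - q y| ≤ η / M := fun y hy => by
      rw [abs_sub_comm]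
      exact (hqφ y hy).le
    refine ⟨_, isC1Limit_integral_of_mem_expAlgebra μ hexp hf.continuous hfc hq,
      fun p hp => ⟨?_, ?_⟩⟩
    · refine (norm_integral_smul_sub_le μ hφ q.continuous hf.continuous hfc subset_rfl
        hclose hp).trans ?_
      rw [div_mul_eq_mul_div, div_le_iff₀ hM]
      exact mul_le_mul_of_nonneg_left (by simp only [M]; linarith) hη.le
    · rw [(hasFDerivAt_integral_smul_comp_sub μ hφ hf hfc p).fderiv,
        (hasFDerivAt_integral_smul_comp_sub μ q.continuous hf hfc p).fderiv]
      refine (norm_integral_smul_sub_le μ hφ q.continuous hfd hfdc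
        (tsupport_fderiv_subset ℝ) hclose hp).trans ?_
      rw [div_mul_eq_mul_div, div_le_iff₀ hM]
      exact mul_le_mul_of_nonneg_left (by simp only [M]; linarith) hη.le
  · rw [← Real.dist_eq, dist_comm]
    exact φ.dist_normed_convolution_le hf.continuous.aestronglyMeasurable fun x hx =>
      (h₁ ((Metric.mem_ball.1 hx).trans_le (min_le_left _ _))).le
  · rw [(hasFDerivAt_integral_smul_comp_sub μ hφ hf hfc p).fderiv, ← dist_eq_norm, dist_comm]
    exact φ.dist_normed_convolution_le hfd.aestronglyMeasurable fun x hx =>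
      (h₂ ((Metric.mem_ball.1 hx).trans_le (min_le_right _ _))).le

end C1Limit

/-! ### From convex bodies to the whole space -/

theorem exists_contDiff_hasCompactSupport_eqOn_one {E : Type*} [NormedAddCommGroup E]
    [NormedSpace ℝ E] [FiniteDimensional ℝ E] {K U : Set E} (hK : IsCompact K) (hU : IsOpen U)
    (hKU : K ⊆ U) : ∃ χ : E → ℝ, ContDiff ℝ ∞ χ ∧ HasCompactSupport χ ∧ tsupport χ ⊆ U ∧
      EqOn χ 1 K := by
  obtain ⟨V, hV, hKV, hVU, hVc⟩ := exists_open_between_and_isCompact_closure hK hU hKU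
  obtain ⟨χ, h0, h1, -⟩ := exists_contMDiffMap_zero_one_of_isClosed (n := ⊤) 𝓘(ℝ, E)
    hV.isClosed_compl hK.isClosed (disjoint_compl_left_iff_subset.2 hKV)
  have hs : tsupport χ ⊆ closure V := closure_mono fun p hp => by
    by_contra hn
    exact hp (h0 hn)
  exact ⟨χ, χ.contMDiff.contDiff, hVc.of_isClosed_subset (isClosed_tsupport _) hs,
    hs.trans hVU, h1⟩

/-- A function that is `C¹` on a convex compact set with nonempty interior is approximated there,
together with its derivative in the interior, by compactly supported `C¹` functions. -/
theorem exists_contDiff_near_of_convex {E : Type*} [NormedAddCommGroup E] [NormedSpace ℝ E]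
    [FiniteDimensional ℝ E] {K : Set E} (hK : IsCompact K) (hconv : Convex ℝ K)
    (hint : (interior K).Nonempty) {f : E → ℝ} (hf : ContDiffOn ℝ 1 f K) {ε : ℝ} (hε : 0 < ε) :
    ∃ g : E → ℝ, ContDiff ℝ 1 g ∧ HasCompactSupport g ∧ (∀ p ∈ K, |f p - g p| ≤ ε) ∧
      ∀ p ∈ interior K, ‖fderiv ℝ f p - fderiv ℝ g p‖ ≤ ε := by
  have hF : ContinuousOn (fderivWithin ℝ f K) K :=
    hf.continuousOn_fderivWithin (uniqueDiffOn_convex hconv hint) le_rfl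
  have hF' : ∀ p ∈ interior K, fderivWithin ℝ f K p = fderiv ℝ f p := fun p hp =>
    fderivWithin_of_mem_nhds (mem_interior_iff_mem_nhds.1 hp)
  have hfi : ∀ p ∈ interior K, ContDiffAt ℝ 1 f p := fun p hp =>
    hf.contDiffAt (mem_interior_iff_mem_nhds.1 hp)
  obtain ⟨c, hc⟩ := hint
  obtain ⟨D, hD⟩ := hK.exists_bound_of_continuousOn (f := fun p => c - p) (by fun_prop)
  obtain ⟨M, hM⟩ := hK.exists_bound_of_continuousOn hF
  obtain ⟨r₁, hr₁, h₁⟩ := Metric.uniformContinuousOn_iff.1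
    (hK.uniformContinuousOn_of_continuous hf.continuousOn) ε hε
  obtain ⟨r₂, hr₂, h₂⟩ := Metric.uniformContinuousOn_iff.1
    (hK.uniformContinuousOn_of_continuous hF) (ε / 2) (by positivity)
  have hcK := interior_subset hc
  have hD0 : 0 ≤ D := (norm_nonneg _).trans (hD c hcK)
  have hM0 : 0 ≤ M := (norm_nonneg _).trans (hM c hcK)
  -- `δ * D` bounds the displacement by the contraction, `δ * M` the loss from the factor `1 - δ` in
  -- its derivative.
  obtain ⟨δ, hδ0, hδ1, hδM, hδr⟩ : ∃ δ : ℝ, 0 < δ ∧ δ ≤ 1 ∧ δ * M ≤ ε / 2 ∧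
      δ * D < min r₁ r₂ := by
    have hr : 0 < min r₁ r₂ := lt_min hr₁ hr₂
    refine ⟨min 1 (min (ε / 2 / (M + 1)) (min r₁ r₂ / (D + 1))), by positivity,
      min_le_left _ _, ?_, ?_⟩
    · have h : min 1 (min (ε / 2 / (M + 1)) (min r₁ r₂ / (D + 1))) ≤ ε / 2 / (M + 1) :=
        (min_le_right _ _).trans (min_le_left _ _)
      refine (mul_le_mul_of_nonneg_right h hM0).trans ?_
      rw [div_mul_eq_mul_div, div_le_iff₀ (by positivity)]
      nlinarith
    · have h : min 1 (min (ε / 2 / (M + 1)) (min r₁ r₂ / (D + 1))) ≤ min r₁ r₂ / (D + 1) :=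
        (min_le_right _ _).trans (min_le_right _ _)
      refine (mul_le_mul_of_nonneg_right h hD0).trans_lt ?_
      rw [div_mul_eq_mul_div, div_lt_iff₀ (by positivity)]
      nlinarith
  let A : E → E := fun p => δ • c + (1 - δ) • p
  have hA : ContDiff ℝ ∞ A := by fun_prop
  have hAi : ∀ p ∈ K, A p ∈ interior K := fun p hp =>
    hconv.combo_interior_self_mem_interior hc hp hδ0 (by linarith) (by ring)
  have hAp : ∀ p ∈ K, dist (A p) p < min r₁ r₂ := by
    intro p hp
    have e : A p - p = δ • (c - p) := by simp only [A]; module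
    rw [dist_eq_norm, e, norm_smul, Real.norm_eq_abs, abs_of_pos hδ0]
    exact (mul_le_mul_of_nonneg_left (hD p hp) hδ0.le).trans_lt hδr
  have hAd : ∀ p, HasFDerivAt A ((1 - δ) • ContinuousLinearMap.id ℝ E) p := fun p =>
    ((hasFDerivAt_id p).const_smul (1 - δ)).const_add (δ • c)
  -- The support of `χ` lies where `A` lands in the interior, so `χ * (f ∘ A)` is `C¹` everywhere.
  obtain ⟨χ, hχ, hχc, hχU, hχ1⟩ := exists_contDiff_hasCompactSupport_eqOn_one hK
    (isOpen_interior.preimage hA.continuous) hAi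
  have hg1 : ∀ p ∈ K, χ p * f (A p) = f (A p) := fun p hp => by simp [hχ1 hp]
  refine ⟨fun p => χ p * f (A p), ?_, hχc.mul_right, fun p hp => ?_, fun p hp => ?_⟩
  · rw [contDiff_iff_contDiffAt]
    intro p
    by_cases hp : p ∈ tsupport χ
    · exact (hχ.of_le (by simp)).contDiffAt.mul
        ((hfi _ (hχU hp)).comp p (hA.of_le (by simp)).contDiffAt)
    · refine (contDiffAt_const (c := (0 : ℝ))).congr_of_eventuallyEq ?_
      filter_upwards [notMem_tsupport_iff_eventuallyEq.1 hp] with y hy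
      simp [hy]
  · simp only [hg1 p hp]
    rw [← Real.dist_eq, dist_comm]
    exact (h₁ _ (interior_subset (hAi p hp)) p hp
      ((hAp p hp).trans_le (min_le_left _ _))).le
  · have hpK := interior_subset hp
    have e : (fun p => χ p * f (A p)) =ᶠ[𝓝 p] f ∘ A := by
      filter_upwards [mem_interior_iff_mem_nhds.1 hp] with y hy
      exact hg1 y hy
    have hd := ((hfi _ (hAi p hpK)).differentiableAt one_ne_zero).hasFDerivAt.comp p (hAd p)
    rw [e.fderiv_eq, hd.fderiv, ContinuousLinearMap.comp_smul, ContinuousLinearMap.comp_id,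
      ← hF' _ hp, ← hF' _ (hAi p hpK)]
    have h3 := h₂ _ (interior_subset (hAi p hpK)) p hpK
      ((hAp p hpK).trans_le (min_le_right _ _))
    rw [dist_eq_norm] at h3
    have e2 : fderivWithin ℝ f K p - (1 - δ) • fderivWithin ℝ f K (A p)
        = -(fderivWithin ℝ f K (A p) - fderivWithin ℝ f K p)
          + δ • fderivWithin ℝ f K (A p) := by module
    rw [e2]
    refine (norm_add_le _ _).trans ?_
    rw [norm_neg, norm_smul, Real.norm_eq_abs, abs_of_pos hδ0]
    have h4 := mul_le_mul_of_nonneg_left (hM _ (interior_subset (hAi p hpK))) hδ0.le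
    linarith

/-- Universal approximation in `C¹`: superpositions of a `C¹` ridge profile that is not a
polynomial approximate `C¹` functions on convex bodies together with their derivatives. -/
theorem exists_mem_ridgeSpan_near {E : Type*} [NormedAddCommGroup E] [NormedSpace ℝ E]
    [FiniteDimensional ℝ E] {σ : ℝ → ℝ} (hσ : ContDiff ℝ 1 σ)
    (hpoly : ¬ ∃ p : Polynomial ℝ, ∀ x, σ x = p.eval x) {K : Set E} (hK : IsCompact K)
    (hconv : Convex ℝ K) (hint : (interior K).Nonempty) {f : E → ℝ} (hf : ContDiffOn ℝ 1 f K)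
    {ε : ℝ} (hε : 0 < ε) :
    ∃ u ∈ ridgeSpan E σ, ContDiff ℝ 1 u ∧ (∀ p ∈ K, |f p - u p| ≤ ε) ∧
      ∀ p ∈ interior K, ‖fderiv ℝ f p - fderiv ℝ u p‖ ≤ ε := by
  borelize E
  obtain ⟨g, hg, hgc, hg1, hg2⟩ :=
    exists_contDiff_near_of_convex hK hconv hint hf (half_pos hε)
  obtain ⟨u, hu, hu1, hu2⟩ := (isC1Limit_of_hasCompactSupport hK
    (isC1Limit_exp hσ hpoly hK) hg hgc).2 (ε / 2) (half_pos hε)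
  refine ⟨u, hu, hu1, fun p hp => ?_, fun p hp => ?_⟩
  · exact (abs_sub_le _ (g p) _).trans (by linarith [hg1 p hp, (hu2 p hp).1])
  · exact (norm_sub_le_norm_sub_add_norm_sub _ (fderiv ℝ g p) _).trans
      (by linarith [hg2 p hp, (hu2 p (interior_subset hp)).2])

/-! ### Networks, partial derivatives and flux continuity -/

theorem exists_twoLayerNet_of_mem_ridgeSpan {σ : ℝ → ℝ} {u : ℝ × ℝ → ℝ}
    (hu : u ∈ ridgeSpan (ℝ × ℝ) σ) : ∃ θ : TwoLayerNet, Function.uncurry (θ.eval σ) = u := by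
  obtain ⟨n, c, q, hq⟩ := Submodule.mem_span_set'.1 hu
  choose r hr using fun i => (q i).2
  refine ⟨⟨n, fun i => (r i).1 (1, 0), fun i => (r i).1 (0, 1), fun i => (r i).2, c, 0⟩, ?_⟩
  funext ⟨t, x⟩
  have e : ∀ ℓ : ℝ × ℝ →L[ℝ] ℝ, ℓ (t, x) = ℓ (1, 0) * t + ℓ (0, 1) * x := by
    intro ℓ
    have h : (t, x) = t • ((1 : ℝ), (0 : ℝ)) + x • ((0 : ℝ), (1 : ℝ)) := by simp
    rw [h, map_add, map_smul, map_smul, smul_eq_mul, smul_eq_mul]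
    ring
  rw [← hq]
  simp [Function.uncurry, TwoLayerNet.eval, Finset.sum_apply, ← hr, e]

theorem FullyConnectedNet.continuous_eval {n k : ℕ} (N : FullyConnectedNet n k) :
    Continuous N.eval := by
  induction N with
  | input W b =>
    exact (Continuous.matrix_mulVec (A := fun _ => W) continuous_const continuous_id).add
      continuous_const
  | layer N act W b ih =>
    refine (Continuous.matrix_mulVec (A := fun _ => W) continuous_const ?_).add continuous_const
    exact continuous_pi fun i => act.continuous.comp ((continuous_apply i).comp ih)

theorem dt_eq_fderiv {f : ℝ → ℝ → ℝ} {p : ℝ × ℝ}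
    (hf : DifferentiableAt ℝ (Function.uncurry f) p) :
    dt f p.1 p.2 = fderiv ℝ (Function.uncurry f) p (1, 0) := by
  have h : HasDerivAt (fun s => ((s, p.2) : ℝ × ℝ)) (1, 0) p.1 :=
    (hasDerivAt_id p.1).prodMk (hasDerivAt_const _ _)
  exact (HasFDerivAt.comp_hasDerivAt p.1 hf.hasFDerivAt h).deriv

theorem dx_eq_fderiv {f : ℝ → ℝ → ℝ} {p : ℝ × ℝ}
    (hf : DifferentiableAt ℝ (Function.uncurry f) p) :
    dx f p.1 p.2 = fderiv ℝ (Function.uncurry f) p (0, 1) := by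
  have h : HasDerivAt (fun s => ((p.1, s) : ℝ × ℝ)) (0, 1) p.2 :=
    (hasDerivAt_const _ _).prodMk (hasDerivAt_id p.2)
  exact (HasFDerivAt.comp_hasDerivAt p.2 hf.hasFDerivAt h).deriv

theorem continuous_dt {u : ℝ → ℝ → ℝ} (hu : ContDiff ℝ 1 (Function.uncurry u)) :
    Continuous fun p : ℝ × ℝ => dt u p.1 p.2 := by
  simp_rw [dt_eq_fderiv (hu.differentiable one_ne_zero _)]
  exact (hu.continuous_fderiv one_ne_zero).clm_apply continuous_const

theorem continuous_dx {u : ℝ → ℝ → ℝ} (hu : ContDiff ℝ 1 (Function.uncurry u)) :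
    Continuous fun p : ℝ × ℝ => dx u p.1 p.2 := by
  simp_rw [dx_eq_fderiv (hu.differentiable one_ne_zero _)]
  exact (hu.continuous_fderiv one_ne_zero).clm_apply continuous_const

/-- `u` is of class `C¹` and lies within `ε` of `m` on `K`, with first partial derivatives
within `ε` of those of `m` in the interior of `K`. -/
structure IsC1Near (K : Set (ℝ × ℝ)) (ε : ℝ) (m u : ℝ → ℝ → ℝ) : Prop where
  contDiff : ContDiff ℝ 1 (Function.uncurry u)
  value : ∀ p ∈ K, |u p.1 p.2 - m p.1 p.2| ≤ ε
  dt : ∀ p ∈ interior K, |dt u p.1 p.2 - dt m p.1 p.2| ≤ ε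
  dx : ∀ p ∈ interior K, |dx u p.1 p.2 - dx m p.1 p.2| ≤ ε

theorem IsC1Near.mono {K : Set (ℝ × ℝ)} {ε ε' : ℝ} {m u : ℝ → ℝ → ℝ} (h : IsC1Near K ε m u)
    (hε : ε ≤ ε') : IsC1Near K ε' m u :=
  ⟨h.contDiff, fun p hp => (h.value p hp).trans hε, fun p hp => (h.dt p hp).trans hε,
    fun p hp => (h.dx p hp).trans hε⟩

theorem exists_twoLayerNet_isC1Near {σ : ℝ → ℝ} (hσ : ContDiff ℝ 1 σ)
    (hpoly : ¬ ∃ p : Polynomial ℝ, ∀ x, σ x = p.eval x) {K : Set (ℝ × ℝ)} (hK : IsCompact K)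
    (hconv : Convex ℝ K) (hint : (interior K).Nonempty) {m : ℝ → ℝ → ℝ}
    (hm : ContDiffOn ℝ 1 (Function.uncurry m) K) {ε : ℝ} (hε : 0 < ε) :
    ∃ θ : TwoLayerNet, IsC1Near K ε m (θ.eval σ) := by
  obtain ⟨u, hu, hu1, hu2, hu3⟩ := exists_mem_ridgeSpan_near hσ hpoly hK hconv hint hm hε
  obtain ⟨θ, rfl⟩ := exists_twoLayerNet_of_mem_ridgeSpan hu
  have hmd : ∀ p ∈ interior K, DifferentiableAt ℝ (Function.uncurry m) p := fun p hp =>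
    (hm.contDiffAt (mem_interior_iff_mem_nhds.1 hp)).differentiableAt one_ne_zero
  have key : ∀ p ∈ interior K, ∀ v : ℝ × ℝ, ‖v‖ = 1 →
      |fderiv ℝ (Function.uncurry (θ.eval σ)) p v - fderiv ℝ (Function.uncurry m) p v| ≤ ε := by
    intro p hp v hv
    rw [abs_sub_comm, ← sub_apply, ← Real.norm_eq_abs]
    refine (ContinuousLinearMap.le_opNorm _ _).trans ?_
    rw [hv, mul_one]
    exact hu3 p hp
  refine ⟨θ, hu1, fun p hp => ?_, fun p hp => ?_, fun p hp => ?_⟩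
  · rw [abs_sub_comm]
    exact hu2 p hp
  · rw [dt_eq_fderiv (hu1.differentiable one_ne_zero p), dt_eq_fderiv (hmd p hp)]
    exact key p hp _ (by simp [Prod.norm_def])
  · rw [dx_eq_fderiv (hu1.differentiable one_ne_zero p), dx_eq_fderiv (hmd p hp)]
    exact key p hp _ (by simp [Prod.norm_def])

/-- The derivative within `K` is continuous up to the boundary, hence bounded, and agrees with the
full derivative inside. -/
theorem exists_bound_value_dx {K : Set (ℝ × ℝ)} (hK : IsCompact K) (hconv : Convex ℝ K)
    (hint : (interior K).Nonempty) {m : ℝ → ℝ → ℝ}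
    (hm : ContDiffOn ℝ 1 (Function.uncurry m) K) :
    ∃ B : ℝ, ∀ p ∈ interior K, |m p.1 p.2| ≤ B ∧ |dx m p.1 p.2| ≤ B := by
  obtain ⟨B₁, h₁⟩ := hK.exists_bound_of_continuousOn hm.continuousOn
  obtain ⟨B₂, h₂⟩ := hK.exists_bound_of_continuousOn
    (hm.continuousOn_fderivWithin (uniqueDiffOn_convex hconv hint) le_rfl)
  refine ⟨max B₁ B₂, fun p hp => ⟨(h₁ p (interior_subset hp)).trans (le_max_left _ _), ?_⟩⟩
  have hn := mem_interior_iff_mem_nhds.1 hp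
  rw [dx_eq_fderiv ((hm.contDiffAt hn).differentiableAt one_ne_zero),
    ← fderivWithin_of_mem_nhds hn, ← Real.norm_eq_abs]
  refine (ContinuousLinearMap.le_opNorm _ _).trans ?_
  have : ‖((0 : ℝ), (1 : ℝ))‖ = 1 := by simp [Prod.norm_def]
  rw [this, mul_one]
  exact (h₂ p (interior_subset hp)).trans (le_max_right _ _)

/-- The Stage-1 flux depends continuously on the moments in the `C¹` sense. -/
theorem Stage1Flux.exists_delta_eval_near (G : Stage1Flux) {K : Set (ℝ × ℝ)} (hK : IsCompact K)
    (hconv : Convex ℝ K) (hint : (interior K).Nonempty) {m₀ m₁ : ℝ → ℝ → ℝ}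
    (hm₀ : ContDiffOn ℝ 1 (Function.uncurry m₀) K)
    (hm₁ : ContDiffOn ℝ 1 (Function.uncurry m₁) K) {η : ℝ} (hη : 0 < η) :
    ∃ δ > 0, ∀ u₀ u₁, IsC1Near K δ m₀ u₀ → IsC1Near K δ m₁ u₁ → ∀ p ∈ interior K,
      |G.eval u₀ u₁ p.1 p.2 - G.eval m₀ m₁ p.1 p.2| ≤ η := by
  cases G with
  | field q => exact ⟨1, one_pos, fun _ _ _ _ p _ => by simpa [Stage1Flux.eval] using hη.le⟩
  | network N =>
    obtain ⟨B₀, hB₀⟩ := exists_bound_value_dx hK hconv hint hm₀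
    obtain ⟨B₁, hB₁⟩ := exists_bound_value_dx hK hconv hint hm₁
    -- The extra `1` leaves room for the perturbed inputs.
    have huc := (isCompact_closedBall (0 : Fin 4 → ℝ)
      (max B₀ B₁ + 1)).uniformContinuousOn_of_continuous
      (((continuous_apply (0 : Fin 1)).comp N.continuous_eval).continuousOn)
    obtain ⟨δ, hδ, h⟩ := Metric.uniformContinuousOn_iff.1 huc η hη
    have hδ' : 0 < min (δ / 2) 1 := by positivity
    refine ⟨min (δ / 2) 1, hδ', fun u₀ u₁ h₀ h₁ p hp => ?_⟩
    have hpK := interior_subset hp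
    let z : Fin 4 → ℝ := ![m₀ p.1 p.2, m₁ p.1 p.2, dx m₀ p.1 p.2, dx m₁ p.1 p.2]
    let w : Fin 4 → ℝ := ![u₀ p.1 p.2, u₁ p.1 p.2, dx u₀ p.1 p.2, dx u₁ p.1 p.2]
    have hz : ‖z‖ ≤ max B₀ B₁ := by
      have hB : 0 ≤ max B₀ B₁ := ((abs_nonneg _).trans (hB₀ p hp).1).trans (le_max_left _ _)
      rw [pi_norm_le_iff_of_nonneg hB]
      intro i
      fin_cases i
      · exact (hB₀ p hp).1.trans (le_max_left _ _)
      · exact (hB₁ p hp).1.trans (le_max_right _ _)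
      · exact (hB₀ p hp).2.trans (le_max_left _ _)
      · exact (hB₁ p hp).2.trans (le_max_right _ _)
    have hwz : dist w z ≤ min (δ / 2) 1 := by
      rw [dist_pi_le_iff hδ'.le]
      intro i
      fin_cases i
      · exact h₀.value p hpK
      · exact h₁.value p hpK
      · exact h₀.dx p hp
      · exact h₁.dx p hp
    refine (h w ?_ z ?_ ?_).le
    · rw [mem_closedBall_zero_iff]
      have h1 := norm_le_norm_add_norm_sub' w z
      rw [← dist_eq_norm] at h1
      linarith [hwz.trans (min_le_right _ _)]
    · rw [mem_closedBall_zero_iff]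
      linarith
    · exact hwz.trans_lt ((min_le_left _ _).trans_lt (by linarith))

theorem integrableOn_sq_and_integral_sq_le {α : Type*} [MeasurableSpace α] {μ : Measure α}
    {s : Set α} (hs : μ s ≠ ⊤) {f : α → ℝ} {η : ℝ}
    (hf : AEStronglyMeasurable f (μ.restrict s)) (h : ∀ᵐ a ∂μ.restrict s, |f a| ≤ η) :
    IntegrableOn (fun a => f a ^ 2) s μ ∧ |∫ a in s, f a ^ 2 ∂μ| ≤ η ^ 2 * μ.real s := by
  have hb : ∀ᵐ a ∂μ.restrict s, ‖f a ^ 2‖ ≤ η ^ 2 := by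
    filter_upwards [h] with a ha
    rw [norm_pow, Real.norm_eq_abs]
    exact pow_le_pow_left₀ (abs_nonneg _) ha 2
  have : IsFiniteMeasure (μ.restrict s) := ⟨by simpa using hs.lt_top⟩
  refine ⟨Integrable.of_bound (hf.pow 2) _ hb, ?_⟩
  have := norm_setIntegral_le_of_norm_le_const_ae hs.lt_top hb
  exact this

/-! ### Estimating the loss -/

section Solution

variable {T xL xR : ℝ} {Φ : ℝ → ℝ} {G : Stage1Flux} {a₀ a₁ : ℝ → ℝ} {m₀ m₁ : ℝ → ℝ → ℝ}

theorem interior_domainK (T xL xR : ℝ) :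
    interior (domainK T xL xR) = Ioo 0 T ×ˢ Ioo xL xR := by
  rw [domainK, interior_prod_eq, interior_Icc, interior_Icc]

theorem convex_domainK (T xL xR : ℝ) : Convex ℝ (domainK T xL xR) :=
  (convex_Icc _ _).prod (convex_Icc _ _)

theorem isCompact_domainK (T xL xR : ℝ) : IsCompact (domainK T xL xR) :=
  isCompact_Icc.prod isCompact_Icc

theorem ae_restrict_domainK (T xL xR : ℝ) {P : ℝ × ℝ → Prop}
    (h : ∀ p ∈ interior (domainK T xL xR), P p) :
    ∀ᵐ p ∂volume.restrict (domainK T xL xR), P p := by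
  have e : interior (domainK T xL xR) =ᵐ[volume] domainK T xL xR :=
    interior_ae_eq_of_null_frontier ((convex_domainK T xL xR).addHaar_frontier volume)
  rw [← Measure.restrict_congr_set e]
  exact ae_restrict_of_forall_mem isOpen_interior.measurableSet h

/-- No measurability of a field `q` is assumed: the second equation expresses it in the interior
through measurable functions. -/
theorem aestronglyMeasurable_flux (hm : IsC1Solution T xL xR Φ G a₀ a₁ m₀ m₁)
    {u₀ u₁ : ℝ → ℝ → ℝ} (hu₀ : ContDiff ℝ 1 (Function.uncurry u₀))
    (hu₁ : ContDiff ℝ 1 (Function.uncurry u₁)) :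
    AEStronglyMeasurable (fun p : ℝ × ℝ => G.eval u₀ u₁ p.1 p.2)
      (volume.restrict (domainK T xL xR)) := by
  cases G with
  | field q =>
    have h : AEStronglyMeasurable (fun p : ℝ × ℝ =>
        -(fderiv ℝ (Function.uncurry m₁) p (1, 0) + Function.uncurry m₀ p * deriv Φ p.2))
        (volume.restrict (domainK T xL xR)) :=
      ((measurable_fderiv_apply_const ℝ _ _).aestronglyMeasurable.add
        ((hm.contDiffOn₀.continuousOn.aestronglyMeasurable
          (isCompact_domainK _ _ _).measurableSet).mul
          ((measurable_deriv Φ).comp measurable_snd).aestronglyMeasurable)).neg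
    refine h.congr (ae_restrict_domainK T xL xR fun p hp => ?_)
    have hd : DifferentiableAt ℝ (Function.uncurry m₁) p :=
      (hm.contDiffOn₁.contDiffAt (mem_interior_iff_mem_nhds.1 hp)).differentiableAt one_ne_zero
    rw [interior_domainK] at hp
    have := hm.eq₂ p.1 hp.1 p.2 hp.2
    simp only [residual₂, Stage1Flux.eval, dt_eq_fderiv hd] at this
    simp only [Stage1Flux.eval, Function.uncurry_def] at this ⊢
    linarith
  | network N =>
    refine Continuous.aestronglyMeasurable ?_
    refine (continuous_apply (0 : Fin 1)).comp (N.continuous_eval.comp (continuous_pi fun i => ?_))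
    fin_cases i
    · exact hu₀.continuous
    · exact hu₁.continuous
    · exact continuous_dx hu₀
    · exact continuous_dx hu₁

/-- Moments that are close to a solution in the `C¹` sense have small residuals. -/
theorem exists_delta_residual_le (hT : 0 < T) (hx : xL < xR)
    (hΦ' : ∃ C : ℝ, ∀ x ∈ Ioo xL xR, |deriv Φ x| ≤ C)
    (hm : IsC1Solution T xL xR Φ G a₀ a₁ m₀ m₁) {η : ℝ} (hη : 0 < η) :
    ∃ δ > 0, δ ≤ η ∧ ∀ u₀ u₁, IsC1Near (domainK T xL xR) δ m₀ u₀ →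
      IsC1Near (domainK T xL xR) δ m₁ u₁ → ∀ p ∈ interior (domainK T xL xR),
      |residual₁ u₀ u₁ p.1 p.2| ≤ η ∧ |residual₂ Φ G u₀ u₁ p.1 p.2| ≤ η := by
  have hint : (interior (domainK T xL xR)).Nonempty := by
    rw [interior_domainK]
    exact (nonempty_Ioo.2 hT).prod (nonempty_Ioo.2 hx)
  obtain ⟨C, hC⟩ := hΦ'
  obtain ⟨δ₁, hδ₁, hG⟩ := G.exists_delta_eval_near (isCompact_domainK T xL xR)
    (convex_domainK T xL xR) hint hm.contDiffOn₀ hm.contDiffOn₁ (half_pos hη)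
  -- The errors in `∂ₜ m₁` and in `m₀ ∂ₓ Φ` together use `η / 2`; the flux uses the other half.
  have hpos : 0 < η / 2 / (|C| + 1) := by positivity
  have hle : η / 2 / (|C| + 1) ≤ η / 2 := div_le_self (half_pos hη).le (by linarith [abs_nonneg C])
  refine ⟨min δ₁ (η / 2 / (|C| + 1)), lt_min hδ₁ hpos, (min_le_right _ _).trans (by linarith),
    fun u₀ u₁ h₀ h₁ p hp => ?_⟩
  have hGp := hG u₀ u₁ (h₀.mono (min_le_left _ _)) (h₁.mono (min_le_left _ _)) p hp
  replace h₀ := h₀.mono (min_le_right _ _)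
  replace h₁ := h₁.mono (min_le_right _ _)
  have hp' := hp
  rw [interior_domainK] at hp'
  have e₁ := hm.eq₁ p.1 hp'.1 p.2 hp'.2
  have e₂ := hm.eq₂ p.1 hp'.1 p.2 hp'.2
  constructor
  · have e : residual₁ u₀ u₁ p.1 p.2 = (dt u₀ p.1 p.2 - dt m₀ p.1 p.2)
        + (dx u₁ p.1 p.2 - dx m₁ p.1 p.2) := by
      simp only [residual₁] at e₁ ⊢
      linarith
    rw [e]
    exact (abs_add_le _ _).trans (by linarith [h₀.dt p hp, h₁.dx p hp])
  · have e : residual₂ Φ G u₀ u₁ p.1 p.2 = (dt u₁ p.1 p.2 - dt m₁ p.1 p.2)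
        + (G.eval u₀ u₁ p.1 p.2 - G.eval m₀ m₁ p.1 p.2)
        + (u₀ p.1 p.2 - m₀ p.1 p.2) * deriv Φ p.2 := by
      simp only [residual₂] at e₂ ⊢
      linarith
    have h3 : |(u₀ p.1 p.2 - m₀ p.1 p.2) * deriv Φ p.2| ≤ η / 2 / (|C| + 1) * |C| := by
      rw [abs_mul]
      exact mul_le_mul (h₀.value p (interior_subset hp)) ((hC p.2 hp'.2).trans (le_abs_self C))
        (abs_nonneg _) hpos.le
    have h4 : η / 2 / (|C| + 1) + η / 2 / (|C| + 1) * |C| = η / 2 := by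
      field_simp
      ring
    rw [e]
    refine (abs_add_le _ _).trans ?_
    linarith [abs_add_le (dt u₁ p.1 p.2 - dt m₁ p.1 p.2)
      (G.eval u₀ u₁ p.1 p.2 - G.eval m₀ m₁ p.1 p.2), h₁.dt p hp]

theorem initial_loss_le (hT : 0 ≤ T) {η : ℝ} {a : ℝ → ℝ} {m u : ℝ → ℝ → ℝ}
    (hm : ContDiffOn ℝ 1 (Function.uncurry m) (domainK T xL xR))
    (ha : ∀ x ∈ Icc xL xR, m 0 x = a x) (hu : IsC1Near (domainK T xL xR) η m u) :
    IntegrableOn (fun x => (u 0 x - a x) ^ 2) (Icc xL xR) ∧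
      |∫ x in Icc xL xR, (u 0 x - a x) ^ 2| ≤ η ^ 2 * volume.real (Icc xL xR) := by
  have hmem : ∀ x ∈ Icc xL xR, ((0 : ℝ), x) ∈ domainK T xL xR := fun x hx =>
    ⟨left_mem_Icc.2 hT, hx⟩
  have hc : ContinuousOn (fun x => m 0 x) (Icc xL xR) :=
    hm.continuousOn.comp (f := fun x => ((0 : ℝ), x)) (by fun_prop) hmem
  have hc' : Continuous fun x => u 0 x :=
    hu.contDiff.continuous.comp (f := fun x => ((0 : ℝ), x)) (by fun_prop)
  refine integrableOn_sq_and_integral_sq_le (by simp)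
    ((hc'.continuousOn.sub (hc.congr fun x hx => (ha x hx).symm)).aestronglyMeasurable
      measurableSet_Icc) ?_
  refine ae_restrict_of_forall_mem measurableSet_Icc fun x hx => ?_
  rw [← ha x hx]
  exact hu.value _ (hmem x hx)

theorem boundary_loss_le (hx : xL ≤ xR) {η : ℝ} {m u : ℝ → ℝ → ℝ}
    (hm : ∀ t ∈ Icc 0 T, m t xL = m t xR) (hu : IsC1Near (domainK T xL xR) η m u) :
    IntegrableOn (fun s => (u s xL - u s xR) ^ 2) (Icc 0 T) ∧
      |∫ s in Icc 0 T, (u s xL - u s xR) ^ 2| ≤ (2 * η) ^ 2 * volume.real (Icc 0 T) := by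
  have hc : ∀ x, Continuous fun s => u s x := fun x =>
    hu.contDiff.continuous.comp (f := fun s => (s, x)) (by fun_prop)
  refine integrableOn_sq_and_integral_sq_le (by simp)
    ((hc xL).sub (hc xR)).aestronglyMeasurable ?_
  refine ae_restrict_of_forall_mem measurableSet_Icc fun s hs => ?_
  have h1 := hu.value (s, xL) ⟨hs, left_mem_Icc.2 hx⟩
  have h2 := hu.value (s, xR) ⟨hs, right_mem_Icc.2 hx⟩
  simp only [hm s hs] at h1 h2
  rw [abs_le] at *
  constructor <;> linarith [h1.1, h1.2, h2.1, h2.2]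

theorem exists_twoLayerNet_loss_le (hT : 0 < T) (hx : xL < xR)
    (hΦ' : ∃ C : ℝ, ∀ x ∈ Ioo xL xR, |deriv Φ x| ≤ C) (lam₁ lam₂ : ℝ)
    (hm : IsC1Solution T xL xR Φ G a₀ a₁ m₀ m₁) {σ : ℝ → ℝ} (hσ : ContDiff ℝ 1 σ)
    (hpoly : ¬ ∃ p : Polynomial ℝ, ∀ x, σ x = p.eval x) {η : ℝ} (hη : 0 < η) :
    ∃ θ₀ θ₁ : TwoLayerNet, LossIntegrable T xL xR Φ G a₀ a₁ (θ₀.eval σ) (θ₁.eval σ) ∧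
      |lossStage2 T xL xR Φ G a₀ a₁ lam₁ lam₂ (θ₀.eval σ) (θ₁.eval σ)| ≤
        η ^ 2 * (2 * volume.real (domainK T xL xR) + |lam₁| * (8 * volume.real (Icc 0 T))
          + |lam₂| * (2 * volume.real (Icc xL xR))) := by
  have hint : (interior (domainK T xL xR)).Nonempty := by
    rw [interior_domainK]
    exact (nonempty_Ioo.2 hT).prod (nonempty_Ioo.2 hx)
  obtain ⟨δ, hδ, hδη, hres⟩ := exists_delta_residual_le hT hx hΦ' hm hη
  obtain ⟨θ₀, h₀⟩ := exists_twoLayerNet_isC1Near hσ hpoly (isCompact_domainK T xL xR)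
    (convex_domainK T xL xR) hint hm.contDiffOn₀ hδ
  obtain ⟨θ₁, h₁⟩ := exists_twoLayerNet_isC1Near hσ hpoly (isCompact_domainK T xL xR)
    (convex_domainK T xL xR) hint hm.contDiffOn₁ hδ
  replace hres := hres _ _ h₀ h₁
  have n₀ := h₀.mono hδη
  have n₁ := h₁.mono hδη
  have hK : volume (domainK T xL xR) ≠ ⊤ := (isCompact_domainK T xL xR).measure_ne_top
  obtain ⟨i1, b1⟩ := integrableOn_sq_and_integral_sq_le hK
    (f := fun p : ℝ × ℝ => residual₁ (θ₀.eval σ) (θ₁.eval σ) p.1 p.2)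
    (((continuous_dt h₀.contDiff).add (continuous_dx h₁.contDiff)).aestronglyMeasurable)
    (ae_restrict_domainK T xL xR fun p hp => (hres p hp).1)
  obtain ⟨i2, b2⟩ := integrableOn_sq_and_integral_sq_le hK
    (f := fun p : ℝ × ℝ => residual₂ Φ G (θ₀.eval σ) (θ₁.eval σ) p.1 p.2)
    (((continuous_dt h₁.contDiff).aestronglyMeasurable.add
      (aestronglyMeasurable_flux hm h₀.contDiff h₁.contDiff)).add
      (h₀.contDiff.continuous.aestronglyMeasurable.mul
        ((measurable_deriv Φ).comp measurable_snd).aestronglyMeasurable))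
    (ae_restrict_domainK T xL xR fun p hp => (hres p hp).2)
  obtain ⟨i3, b3⟩ := boundary_loss_le hx.le hm.periodic₀ n₀
  obtain ⟨i4, b4⟩ := boundary_loss_le hx.le hm.periodic₁ n₁
  obtain ⟨i5, b5⟩ := initial_loss_le hT.le hm.contDiffOn₀ hm.initial₀ n₀
  obtain ⟨i6, b6⟩ := initial_loss_le hT.le hm.contDiffOn₁ hm.initial₁ n₁
  refine ⟨θ₀, θ₁, ⟨i1, i2, i3, i4, i5, i6⟩, ?_⟩
  -- Absolute values throughout, since the `λ`'s may be negative; the `8` is two moments times `2 ^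
  -- 2`.
  have bGE := (abs_add_le _ _).trans (add_le_add b1 b2)
  have bBC := mul_le_mul_of_nonneg_left ((abs_add_le _ _).trans (add_le_add b3 b4))
    (abs_nonneg lam₁)
  have bIC := mul_le_mul_of_nonneg_left ((abs_add_le _ _).trans (add_le_add b5 b6))
    (abs_nonneg lam₂)
  rw [← abs_mul] at bBC bIC
  refine ((abs_add_le _ _).trans (add_le_add ((abs_add_le _ _).trans
    (add_le_add bGE bBC)) bIC)).trans (le_of_eq ?_)
  ring

end Solution

end MomentPINN

theorem theorem1 (T xL xR : ℝ) (hT : 0 < T) (hx : xL < xR)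
    (Φ : ℝ → ℝ) (hΦ : DifferentiableOn ℝ Φ (Set.Ioo xL xR))
    (hΦ' : ∃ C : ℝ, ∀ x ∈ Set.Ioo xL xR, |deriv Φ x| ≤ C)
    (G : MomentPINN.Stage1Flux) (lam₁ lam₂ : ℝ)
    (a₀ a₁ : ℝ → ℝ) (m₀ m₁ : ℝ → ℝ → ℝ)
    (hm : MomentPINN.IsC1Solution T xL xR Φ G a₀ a₁ m₀ m₁)
    (σ : ℝ → ℝ) (hσ : ContDiff ℝ 1 σ)
    (hσ_poly : ¬ ∃ p : Polynomial ℝ, ∀ x, σ x = p.eval x) :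
    ∃ θ₀ θ₁ : ℕ → MomentPINN.TwoLayerNet,
      (∀ j, MomentPINN.LossIntegrable T xL xR Φ G a₀ a₁ ((θ₀ j).eval σ) ((θ₁ j).eval σ)) ∧
      Filter.Tendsto
        (fun j => MomentPINN.lossStage2 T xL xR Φ G a₀ a₁ lam₁ lam₂
          ((θ₀ j).eval σ) ((θ₁ j).eval σ))
        Filter.atTop (nhds 0) := by
  choose θ₀ θ₁ hint hle using fun j : ℕ => MomentPINN.exists_twoLayerNet_loss_le hT hx hΦ'
    lam₁ lam₂ hm hσ hσ_poly (Nat.one_div_pos_of_nat (α := ℝ) (n := j))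
  refine ⟨θ₀, θ₁, hint, squeeze_zero_norm hle ?_⟩
  have h := (tendsto_one_div_add_atTop_nhds_zero_nat (𝕜 := ℝ)).pow 2
  simpa using h.mul_const _
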